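/- Let $\mathbb K$ be $\mathbb R$ or $\mathbb C$. Let $\Lambda$ be the Banach algebra of supernumbers: the formal series $z=\sum_I z_I\zeta^I$, $z_I\in\mathbb K$, over all finite increasing multi-indices $I$ in countably infinitely many anticommuting generators $\zeta^1,\zeta^2,\dots$, with $\|z\|=\sum_I|z_I|<\infty$; let ${}^0\Lambda$ and ${}^1\Lambda$ be its even and odd parts. Let $\mathbb K^{p|q}=({}^0\Lambda)^p\times({}^1\Lambda)^q$ with the norm $\|z\|=\sum_{A=1}^{p+q}\|z^A\|$. For $U\subseteq\mathbb K^{p|q}$ open, a function $g:U\to\Lambda$ is of class $G^0$ if it is continuous; it is of class $G^{s+1}$ if there are functions $G_Ag:U\to\Lambda$ of class $G^s$, $1\le A\le p+q$, such that for every $a\in U$ $$g(a+h)=g(a)+\sum_{A=1}^{p+q}h^A\,(G_Ag)(a)+o(\|h\|)\qquad(h\to0);$$ it is of class $G^\infty$ if it is of class $G^s$ for all $s$. A map into $\mathbb K^{r|s}$ is of class $G^l$ if all its components are. A supermanifold of dimension $(p|q)$ is a Hausdorff space $\mathcal M$ with a maximal atlas of charts $(U,\psi)$ in $\mathbb K^{p|q}$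 with $G^\infty$ changes of charts; the same charts make it a $C^\infty$ Banach manifold over $\mathbb K$, denoted $\mathcal{BM}$. A map $f:\mathcal M\to\mathcal N$ of supermanifolds is of class $G^l$ if it is continuous and $\phi\circ f\circ\psi^{-1}$ is of class $G^l$ on $\psi(U\cap f^{-1}(V))$ for all charts $(U,\psi)$ of $\mathcal M$ and $(V,\phi)$ of $\mathcal N$. A tangent vector of $\mathcal M$ at $x$ is a map from the germs at $x$ of $\Lambda$-valued $G^\infty$ functions to $\Lambda$ that is induced by a $G^\infty$ vector field (a sum of an even and an odd superderivation of the $G^\infty$ functions) near $x$; it is even, written $X\in T^0_x\mathcal M$, if it preserves the parity of even and of odd germs. Its components in a chart $\psi=(z^1,\dots,z^{p+q})$ at $x$ are $X^A=X(z^A)$, so that $(X^A)_A\in\mathbb K^{p|q}$. For $g:\mathcal M\to\Lambda$ that is $C^\infty$ near $x$, and a chart $\psi$ at $x$, put $$d^k_xg(X_1,\dots,X_k)=d^k_{\psi(x)}(g\circ\psi^{-1})\bigl((X_1^A)_A,\dots,(X_k^A)_A\bigr),\qquad X_1,\dots,X_k\in T^0_x\mathcal M,$$ where $d^k$ on the right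 is the $k$-th iterated Fréchet derivative. **Theorem.** Let $\mathcal M$ and $\mathcal N$ be supermanifolds of dimensions $(p|q)$ and $(r|s)$, let $f:\mathcal{BM}\to\mathcal{BN}$ be a $C^\infty$ map, and let $l\in\{0,1,2,\dots\}\cup\{\infty\}$. Then $f:\mathcal M\to\mathcal N$ is of class $G^l$ if and only if for every chart $(U,\psi)$ of $\mathcal M$ and every chart $(V,\phi)$ of $\mathcal N$ with $f(U)\subseteq V$ there are functions $b^{\psi J}_{A_1\dots A_k}:U\to\Lambda$, for all finite $k$ with $1\le k\le l$, $1\le A_1,\dots,A_k\le p+q$ and $1\le J\le r+s$, such that 1. each $b^{\psi J}_{A_1\dots A_k}$ is continuous on $U$, and 2. for all $x\in U$ and $X_1,\dots,X_k\in T^0_x\mathcal M$, with components and derivatives taken in the chart $\psi$, $$d^k_x(\phi^J\circ f)(X_1,\dots,X_k)=\sum_{A_1=1}^{p+q}\cdots\sum_{A_k=1}^{p+q}X_1^{A_1}\cdots X_k^{A_k}\,b^{\psi J}_{A_1\dots A_k}(x).$$ -/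

import Mathlib

open scoped ContDiff Manifold Topology

noncomputable section

/-- The supernumbers `Λ` over `K`: series `∑ z_I ζ^I` in anticommuting generators `ζ^0, ζ^1, …`,
indexed by the finite sets `I` of (increasingly ordered) generators, with `∑ |z_I| < ∞`;
the norm is `‖z‖ = ∑ |z_I|`. -/
def Supernumber (K : Type*) [RCLike K] : Type _ := lp (fun _ : Finset ℕ => K) 1

namespace Supernumber

variable {K : Type*} [RCLike K]

instance : NormedAddCommGroup (Supernumber K) :=
  inferInstanceAs (NormedAddCommGroup (lp (fun _ : Finset ℕ => K) 1))

instance : NormedSpace K (Supernumber K) :=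
  inferInstanceAs (NormedSpace K (lp (fun _ : Finset ℕ => K) 1))

instance : CompleteSpace (Supernumber K) :=
  inferInstanceAs (CompleteSpace (lp (fun _ : Finset ℕ => K) 1))

/-- The coefficient `z_I` of `ζ^I` in `z`. -/
def coeff (z : Supernumber K) (I : Finset ℕ) : K := (z.1 : Finset ℕ → K) I

theorem ext_coeff {z w : Supernumber K} (h : ∀ I, z.coeff I = w.coeff I) : z = w :=
  Subtype.ext (funext h)

theorem summable_coeff (z : Supernumber K) : Summable fun I => ‖z.coeff I‖ := by
  have h := lp.memℓp (E := fun _ : Finset ℕ => K) (p := 1) z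
  have h2 := (memℓp_gen_iff (by norm_num)).1 h
  simp at h2
  exact h2

theorem norm_eq_tsum (z : Supernumber K) : ‖z‖ = ∑' I, ‖z.coeff I‖ := by
  have h := lp.norm_eq_tsum_rpow (E := fun _ : Finset ℕ => K) (p := 1) (by norm_num) z
  simp at h
  exact h

/-- The supernumber with given absolutely summable coefficients. -/
def mk (c : Finset ℕ → K) (hc : Summable fun I => ‖c I‖) : Supernumber K :=
  (⟨c, (memℓp_gen_iff (by norm_num)).2 (by simpa using hc)⟩ : lp (fun _ : Finset ℕ => K) 1)

@[simp] theorem coeff_mk (c : Finset ℕ → K) (hc) (I) : (mk c hc).coeff I = c I := rfl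
@[simp] theorem coeff_add (z w : Supernumber K) (I) :
    (z + w).coeff I = z.coeff I + w.coeff I := rfl
@[simp] theorem coeff_smul (a : K) (z : Supernumber K) (I) :
    (a • z).coeff I = a * z.coeff I := rfl
@[simp] theorem coeff_zero (I) : (0 : Supernumber K).coeff I = 0 := rfl

/-- The number of inversions between `I` and `J`: for disjoint `I`, `J` one has
`ζ^I ζ^J = (-1)^(inv I J) ζ^(I ∪ J)`. -/
def inv (I J : Finset ℕ) : ℕ := ((I ×ˢ J).filter fun ij => ij.2 < ij.1).card

/-- The coefficient of `ζ^L` in the product `z w`, using `ζ^I ζ^J = (-1)^(inv I J) ζ^(I ∪ J)`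
for disjoint `I`, `J`, and `ζ^I ζ^J = 0` otherwise. -/
def mulCoeff (z w : Supernumber K) (L : Finset ℕ) : K :=
  ∑ I ∈ L.powerset, (-1) ^ inv I (L \ I) * (z.coeff I * w.coeff (L \ I))

theorem mulCoeff_bound (z w : Supernumber K) :
    (Summable fun L => ‖mulCoeff z w L‖) ∧ ∑' L, ‖mulCoeff z w L‖ ≤ ‖z‖ * ‖w‖ := by
  let F : Finset ℕ × Finset ℕ → ℝ := fun IJ => ‖z.coeff IJ.1‖ * ‖w.coeff IJ.2‖
  have hF : Summable F := z.summable_coeff.mul_of_nonneg w.summable_coeff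
    (fun _ => norm_nonneg _) (fun _ => norm_nonneg _)
  let e : (Σ L : Finset ℕ, {I // I ∈ L.powerset}) → Finset ℕ × Finset ℕ :=
    fun x => (x.2.1, x.1 \ x.2.1)
  have he : Function.Injective e := by
    rintro ⟨L, I, hI⟩ ⟨L', I', hI'⟩ h
    simp only [e, Prod.mk.injEq] at h
    obtain ⟨rfl, h⟩ := h
    have : L = L' := by
      rw [← Finset.union_sdiff_of_subset (Finset.mem_powerset.1 hI), h,
        Finset.union_sdiff_of_subset (Finset.mem_powerset.1 hI')]
    subst this
    rfl
  have hS : Summable (F ∘ e) := hF.comp_injective he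
  have hS1 := hS.sigma
  have hle : ∀ L, ‖mulCoeff z w L‖ ≤ ∑' I : {I // I ∈ L.powerset}, (F ∘ e) ⟨L, I⟩ := by
    intro L
    rw [tsum_fintype, Finset.univ_eq_attach]
    change _ ≤ ∑ I ∈ L.powerset.attach, (fun I => F (I, L \ I)) I.1
    rw [Finset.sum_attach L.powerset (fun I => F (I, L \ I))]
    refine (norm_sum_le _ _).trans (Finset.sum_le_sum fun I _ => ?_)
    simp [F]
  have hsum : Summable fun L => ‖mulCoeff z w L‖ :=
    Summable.of_nonneg_of_le (fun _ => norm_nonneg _) hle hS1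
  refine ⟨hsum, (hsum.tsum_le_tsum hle hS1).trans ?_⟩
  rw [← hS.tsum_sigma, norm_eq_tsum z, norm_eq_tsum w,
    z.summable_coeff.tsum_mul_tsum w.summable_coeff hF]
  exact tsum_comp_le_tsum_of_inj hF (fun _ => by positivity) he

instance : Mul (Supernumber K) := ⟨fun z w => mk (mulCoeff z w) (mulCoeff_bound z w).1⟩

theorem coeff_mul (z w : Supernumber K) (L : Finset ℕ) : (z * w).coeff L =
    ∑ I ∈ L.powerset, (-1) ^ inv I (L \ I) * (z.coeff I * w.coeff (L \ I)) := rfl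

instance : One (Supernumber K) :=
  ⟨mk (fun I => if I = ∅ then 1 else 0)
    (summable_of_ne_finset_zero (s := {∅}) (by intro I hI; simp_all))⟩

theorem coeff_one (I : Finset ℕ) : (1 : Supernumber K).coeff I = if I = ∅ then 1 else 0 := rfl

theorem inv_union_left {I J L : Finset ℕ} (h : Disjoint I J) :
    inv (I ∪ J) L = inv I L + inv J L := by
  unfold inv
  rw [Finset.union_product, Finset.filter_union, Finset.card_union_of_disjoint]
  exact Finset.disjoint_filter_filter
    (Finset.disjoint_product.2 (Or.inl h))

theorem inv_union_right {I J L : Finset ℕ} (h : Disjoint J L) :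
    inv I (J ∪ L) = inv I J + inv I L := by
  unfold inv
  rw [Finset.product_union, Finset.filter_union, Finset.card_union_of_disjoint]
  exact Finset.disjoint_filter_filter
    (Finset.disjoint_product.2 (Or.inr h))

theorem mul_assoc_aux (x y z : Supernumber K) : x * y * z = x * (y * z) := by
  refine ext_coeff fun L => ?_
  simp only [coeff_mul, Finset.mul_sum, Finset.sum_mul]
  rw [Finset.sum_sigma', Finset.sum_sigma']
  refine Finset.sum_bij' (fun a _ => ⟨a.2, a.1 \ a.2⟩) (fun a _ => ⟨a.1 ∪ a.2, a.1⟩)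
    ?_ ?_ ?_ ?_ ?_
  · rintro ⟨I, J⟩ h
    simp only [Finset.mem_sigma, Finset.mem_powerset] at h ⊢
    exact ⟨h.2.trans h.1, Finset.sdiff_subset_sdiff h.1 le_rfl⟩
  · rintro ⟨J, P⟩ h
    simp only [Finset.mem_sigma, Finset.mem_powerset] at h ⊢
    exact ⟨Finset.union_subset h.1 (h.2.trans Finset.sdiff_subset), Finset.subset_union_left⟩
  · rintro ⟨I, J⟩ h
    simp only [Finset.mem_sigma, Finset.mem_powerset] at h ⊢
    simp [Finset.union_sdiff_of_subset h.2]
  · rintro ⟨J, P⟩ h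
    simp only [Finset.mem_sigma, Finset.mem_powerset] at h ⊢
    have hd : Disjoint J P := (Finset.disjoint_sdiff).mono_right h.2
    simp [Finset.union_sdiff_cancel_left hd]
  · rintro ⟨I, J⟩ h
    simp only [Finset.mem_sigma, Finset.mem_powerset] at h ⊢
    obtain ⟨hI, hJ⟩ := h
    have e1 : (L \ J) \ (I \ J) = L \ I := by
      ext a
      simp only [Finset.mem_sdiff]
      have := @hJ a
      tauto
    have e2 : L \ J = (I \ J) ∪ (L \ I) := by
      ext a
      simp only [Finset.mem_sdiff, Finset.mem_union]
      have := @hJ a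
      have := @hI a
      tauto
    have d2 : Disjoint (I \ J) (L \ I) :=
      Finset.disjoint_of_subset_left Finset.sdiff_subset Finset.disjoint_sdiff
    have s1 : inv I (L \ I) = inv J (L \ I) + inv (I \ J) (L \ I) := by
      conv_lhs => rw [← Finset.union_sdiff_of_subset hJ]
      rw [Finset.union_sdiff_of_subset hJ]
      conv_lhs => enter [1]; rw [← Finset.union_sdiff_of_subset hJ]
      exact inv_union_left Finset.disjoint_sdiff
    have s2 : inv J (L \ J) = inv J (I \ J) + inv J (L \ I) := by
      rw [e2, inv_union_right d2]
    rw [e1, s1, s2]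
    ring

theorem one_mul_aux (z : Supernumber K) : 1 * z = z := by
  refine ext_coeff fun L => ?_
  rw [coeff_mul, Finset.sum_eq_single ∅]
  · simp [coeff_one, inv]
  · intro I _ hI
    simp [coeff_one, hI]
  · simp

theorem mul_one_aux (z : Supernumber K) : z * 1 = z := by
  refine ext_coeff fun L => ?_
  rw [coeff_mul, Finset.sum_eq_single L]
  · simp [coeff_one, inv]
  · intro I hI hne
    have : L \ I ≠ ∅ := by
      intro h
      exact hne (le_antisymm (Finset.mem_powerset.1 hI) (Finset.sdiff_eq_empty_iff_subset.1 h))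
    simp [coeff_one, this]
  · simp

instance : NormedRing (Supernumber K) :=
  { (inferInstance : NormedAddCommGroup (Supernumber K)) with
    mul := (· * ·)
    one := 1
    mul_assoc := mul_assoc_aux
    one_mul := one_mul_aux
    mul_one := mul_one_aux
    zero_mul := fun z => ext_coeff fun L => by simp [coeff_mul]
    mul_zero := fun z => ext_coeff fun L => by simp [coeff_mul]
    left_distrib := fun x y z => ext_coeff fun L => by
      simp [coeff_mul, mul_add, Finset.sum_add_distrib]
    right_distrib := fun x y z => ext_coeff fun L => by
      simp [coeff_mul, mul_add, add_mul, Finset.sum_add_distrib]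
    norm_mul_le := fun z w => by
      rw [norm_eq_tsum (z * w)]
      exact (mulCoeff_bound z w).2 }

instance : Algebra K (Supernumber K) :=
  Algebra.ofModule
    (fun a x y => ext_coeff fun L => by
      simp only [coeff_mul, coeff_smul, Finset.mul_sum]
      exact Finset.sum_congr rfl fun I _ => by ring)
    (fun a x y => ext_coeff fun L => by
      simp only [coeff_mul, coeff_smul, Finset.mul_sum]
      exact Finset.sum_congr rfl fun I _ => by ring)

instance : NormedAlgebra K (Supernumber K) where
  norm_smul_le := fun a z => norm_smul_le a z

/-- `part K 0` and `part K 1` are the even and the odd supernumbers. -/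
def part (K : Type*) [RCLike K] (ε : ZMod 2) : Submodule K (Supernumber K) where
  carrier := {z | ∀ I : Finset ℕ, (I.card : ZMod 2) ≠ ε → z.coeff I = 0}
  add_mem' := fun {z w} hz hw I hI => by simp [hz I hI, hw I hI]
  zero_mem' := fun _ _ => rfl
  smul_mem' := fun a z hz I hI => by simp [hz I hI]

end Supernumber

open Supernumber

/-- The parity of a coordinate index: the first `p` coordinates are even, the last `q` odd. -/
def indexParity {p q : ℕ} : Fin p ⊕ Fin q → ZMod 2 := Sum.elim (fun _ => 0) (fun _ => 1)

/-- `K^{p|q}`, as a subspace of `Λ^{p+q}` with the norm `‖z‖ = ∑ ‖z^A‖`. -/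
def superSubmodule (K : Type*) [RCLike K] (p q : ℕ) :
    Submodule K (PiLp 1 fun _ : Fin p ⊕ Fin q => Supernumber K) where
  carrier := {z | ∀ A, z A ∈ part K (indexParity A)}
  add_mem' := fun hz hw A => (part K _).add_mem (hz A) (hw A)
  zero_mem' := fun _ => (part K _).zero_mem
  smul_mem' := fun a _ hz A => (part K _).smul_mem a (hz A)

/-- The Banach space `K^{p|q}` of `p` even and `q` odd supernumbers. -/
abbrev SuperSpace (K : Type*) [RCLike K] (p q : ℕ) : Type _ := superSubmodule K p q

/-- `f` is of class `G^s` on `U` (for `U` open), for a natural number `s`: `G^0` means continuous,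
and `G^{s+1}` means that there are functions `G_A f` of class `G^s` on `U` with
`f (a + h) = f a + ∑ h^A (G_A f) a + o(‖h‖)` for every `a ∈ U`. -/
def IsGOnNat {K : Type*} [RCLike K] {p q : ℕ} :
    ℕ → (SuperSpace K p q → Supernumber K) → Set (SuperSpace K p q) → Prop
  | 0, f, U => ContinuousOn f U
  | s + 1, f, U => ∃ G : Fin p ⊕ Fin q → SuperSpace K p q → Supernumber K,
      (∀ a ∈ U, (fun h : SuperSpace K p q => f (a + h) - f a - ∑ A, h.1 A * G A a)
        =o[𝓝 0] (fun h : SuperSpace K p q => h)) ∧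
      ∀ A, IsGOnNat s (G A) U

/-- `f : U → Λ` is of class `G^l`, `l` a natural number or `∞`. -/
def IsGOn {K : Type*} [RCLike K] {p q : ℕ} (l : ℕ∞)
    (f : SuperSpace K p q → Supernumber K) (U : Set (SuperSpace K p q)) : Prop :=
  ∀ s : ℕ, (s : ℕ∞) ≤ l → IsGOnNat s f U

/-- `g : U → K^{r|s}` is of class `G^l`: all its components are. -/
def IsGMapOn {K : Type*} [RCLike K] {p q r s : ℕ} (l : ℕ∞)
    (g : SuperSpace K p q → SuperSpace K r s) (U : Set (SuperSpace K p q)) : Prop :=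
  ∀ J, IsGOn l (fun z => (g z).1 J) U

/-- The change of charts `φ ∘ ψ⁻¹` is of class `G^∞`. -/
def GCompatible {K : Type*} [RCLike K] {p q : ℕ} {M : Type*} [TopologicalSpace M]
    (ψ φ : OpenPartialHomeomorph M (SuperSpace K p q)) : Prop :=
  IsGMapOn ⊤ (fun z => φ (ψ.symm z)) (ψ.symm.trans φ).source

/-- A `G^∞` supermanifold of dimension `(p|q)`: a Hausdorff space with a maximal atlas of charts
in `K^{p|q}` whose changes of charts are of class `G^∞`. The same charts make it a Banach
manifold. -/
class Supermanifold (K : Type*) [RCLike K] (p q : ℕ) (M : Type*) [TopologicalSpace M]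
    extends ChartedSpace (SuperSpace K p q) M where
  hausdorff : T2Space M
  compatible : ∀ ψ ∈ atlas, ∀ φ ∈ atlas, GCompatible ψ φ
  maximal : ∀ ψ : OpenPartialHomeomorph M (SuperSpace K p q),
    (∀ φ ∈ atlas, GCompatible ψ φ ∧ GCompatible φ ψ) → ψ ∈ atlas

section Tangent

variable (K : Type*) [RCLike K] (p q : ℕ) {M : Type*} [TopologicalSpace M] [Supermanifold K p q M]

/-- `f` is of class `G^∞` on the open subset `W` of the supermanifold `M`. -/
def IsGInfty (f : M → Supernumber K) (W : Set M) : Prop :=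
  ∀ ψ ∈ atlas (SuperSpace K p q) M,
    IsGOn ⊤ (fun z => f (ψ.symm z)) (ψ.target ∩ ψ.symm ⁻¹' W)

/-- The germs at `x` of `G^∞` functions. -/
def GGerm (x : M) : Type _ :=
  {g : (𝓝 x).Germ (Supernumber K) //
    ∃ (f : M → Supernumber K) (W : Set M), IsOpen W ∧ x ∈ W ∧ IsGInfty K p q f W ∧ f = g}

/-- The germ at `x` of a function of class `G^∞` on an open neighbourhood `W` of `x`. -/
def GGerm.mk {x : M} (f : M → Supernumber K) (W : Set M) (hW : IsOpen W) (hx : x ∈ W)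
    (hf : IsGInfty K p q f W) : GGerm K p q x :=
  ⟨f, f, W, hW, hx, hf, rfl⟩

/-- The sign `(-1)^{ε δ}`. -/
def superSign (ε δ : ZMod 2) : ℤ := if ε = 1 ∧ δ = 1 then -1 else 1

/-- `X` is a `G^∞` vector field of parity `ε` on the open set `U`. Vector fields are taken together
with their restrictions to open subsets `W` of `U`, so `X` acts on `G^∞` functions on every such
`W`, and `X f` on `W` depends only on `f` on `W`; the values of `X` on other functions, and of
`X f` off `W`, carry no meaning. -/
structure IsPureVectorField (U : Set M) (ε : ZMod 2)
    (X : (M → Supernumber K) → M → Supernumber K) : Prop where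
  restrict : ∀ W ⊆ U, IsOpen W → ∀ f g, IsGInfty K p q f W → IsGInfty K p q g W →
    Set.EqOn f g W → Set.EqOn (X f) (X g) W
  mapsTo : ∀ W ⊆ U, IsOpen W → ∀ f, IsGInfty K p q f W → IsGInfty K p q (X f) W
  parity : ∀ W ⊆ U, IsOpen W → ∀ f, IsGInfty K p q f W → ∀ δ, (∀ y ∈ W, f y ∈ part K δ) →
    ∀ y ∈ W, X f y ∈ part K (ε + δ)
  add : ∀ W ⊆ U, IsOpen W → ∀ f g, IsGInfty K p q f W → IsGInfty K p q g W →
    ∀ y ∈ W, X (fun z => f z + g z) y = X f y + X g y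
  smul : ∀ W ⊆ U, IsOpen W → ∀ f, IsGInfty K p q f W → ∀ c : K,
    ∀ y ∈ W, X (fun z => c • f z) y = c • X f y
  right_linear : ∀ W ⊆ U, IsOpen W → ∀ f, IsGInfty K p q f W → ∀ a : Supernumber K,
    ∀ y ∈ W, X (fun z => f z * a) y = X f y * a
  leibniz : ∀ W ⊆ U, IsOpen W → ∀ f g, IsGInfty K p q f W → IsGInfty K p q g W →
    ∀ δ δ', (∀ y ∈ W, f y ∈ part K δ) → (∀ y ∈ W, g y ∈ part K δ') →
    ∀ y ∈ W, X (fun z => f z * g z) y = X f y * g y + superSign δ ε • (f y * X g y)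
  left_linear : ∀ W ⊆ U, IsOpen W → ∀ f, IsGInfty K p q f W →
    ∀ δ δ', ∀ a ∈ part K δ, (∀ y ∈ W, f y ∈ part K δ') →
    ∀ y ∈ W, X (fun z => a * f z) y = superSign δ ε • (a * X f y)

/-- `X` is a `G^∞` vector field on the open set `U`: the sum of an even and an odd one. -/
def IsVectorField (U : Set M) (X : (M → Supernumber K) → M → Supernumber K) : Prop :=
  ∃ X₀ X₁, IsPureVectorField K p q U 0 X₀ ∧ IsPureVectorField K p q U 1 X₁ ∧
    ∀ W ⊆ U, IsOpen W → ∀ f, IsGInfty K p q f W → ∀ y ∈ W, X f y = X₀ f y + X₁ f y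

/-- The tangent module `T_x M`: maps from the germs of `G^∞` functions at `x` to `Λ` that are
induced by a `G^∞` vector field near `x`. -/
structure SuperTangent (x : M) where
  toFun : GGerm K p q x → Supernumber K
  exists_field : ∃ (U : Set M) (X : (M → Supernumber K) → M → Supernumber K),
    IsOpen U ∧ x ∈ U ∧ IsVectorField K p q U X ∧
    ∀ W ⊆ U, ∀ (hW : IsOpen W) (hx : x ∈ W) (f : M → Supernumber K) (hf : IsGInfty K p q f W),
      toFun (GGerm.mk K p q f W hW hx hf) = X f x

/-- The even tangent vectors `T_x^0 M`: those that preserve parity. -/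
def EvenTangent (x : M) : Type _ :=
  {v : SuperTangent K p q x // ∀ (δ : ZMod 2) (g : GGerm K p q x),
    g.1.LiftPred (fun z => z ∈ part K δ) → v.toFun g ∈ part K δ}

variable {K p q}

theorem isGInfty_coord {ψ : OpenPartialHomeomorph M (SuperSpace K p q)}
    (hψ : ψ ∈ atlas (SuperSpace K p q) M) (A : Fin p ⊕ Fin q) :
    IsGInfty K p q (fun y : M => (ψ y).1 A) ψ.source :=
  fun φ hφ => Supermanifold.compatible φ hφ ψ hψ A

/-- The components `X^A = X(z^A)` of an even tangent vector `X` at `x` in a chart `ψ = (z^A)`.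
They form an element of `K^{p|q}`, which is the value on `ψ` of the vector of the Banach manifold
corresponding to `X`. -/
def EvenTangent.comp {x : M} (X : EvenTangent K p q x)
    {ψ : OpenPartialHomeomorph M (SuperSpace K p q)}
    (hψ : ψ ∈ atlas (SuperSpace K p q) M) (hx : x ∈ ψ.source) : SuperSpace K p q :=
  ⟨WithLp.toLp 1 fun A => X.1.toFun
      (GGerm.mk K p q (fun y => (ψ y).1 A) ψ.source ψ.open_source hx (isGInfty_coord hψ A)),
    fun A => X.2 _ _ (Filter.Eventually.of_forall fun y => (ψ y).2 A)⟩

/-- The `k`-th iterated Fréchet derivative of `g : M → Λ` at `x`, computed in the chart `ψ`,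
on the even tangent vectors `X_1, …, X_k`. -/
def chartDeriv {x : M} {ψ : OpenPartialHomeomorph M (SuperSpace K p q)}
    (hψ : ψ ∈ atlas (SuperSpace K p q) M) (hx : x ∈ ψ.source) (g : M → Supernumber K)
    {k : ℕ} (X : Fin k → EvenTangent K p q x) : Supernumber K :=
  iteratedFDeriv K k (fun z => g (ψ.symm z)) (ψ x) fun i => (X i).comp hψ hx

end Tangent

/-- The map `f : M → N` between supermanifolds is of class `G^l`: it is continuous, and its
representatives `φ ∘ f ∘ ψ⁻¹` in charts are of class `G^l`. -/
def IsGMap (K : Type*) [RCLike K] (p q r s : ℕ) {M N : Type*} [TopologicalSpace M]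
    [Supermanifold K p q M] [TopologicalSpace N] [Supermanifold K r s N]
    (l : ℕ∞) (f : M → N) : Prop :=
  Continuous f ∧ ∀ ψ ∈ atlas (SuperSpace K p q) M, ∀ φ ∈ atlas (SuperSpace K r s) N,
    IsGMapOn l (fun z => φ (f (ψ.symm z))) (ψ.target ∩ ψ.symm ⁻¹' (f ⁻¹' φ.source))

end

/-! In charts the question concerns a smooth function `g` on an open set of `K^{p|q}`: it is of
class G^s exactly when its derivatives of order at most `s` have the form `∑ h_1^{A_1} ⋯ h_k^{A_k}
b_{A_1 … A_k}` with continuous `b`.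

If `g` is of class G^s, differentiating this form once more differentiates the coefficients. The new
factor `h^B` then stands behind the older ones, and supercommutativity moves it to the front at the
cost of a sign (`HasGDeriv.succ`). Induction on `k` gives all the coefficients.

Conversely, the coefficients of order `k` must be shown to be differentiable, with G-derivatives
equal up to sign to those of order `k + 1` (`HasGDeriv.hasFDerivAt`). Smoothness of `g` gives this
only for the products `η_1 ⋯ η_k b_A`, where `η_i` has the parity of `A_i`, and odd supernumbers are
not invertible. The infinitely many generators help here: `‖z‖` is bounded by any common bound of
the `‖ζ^n z‖` (`norm_le_of_gen_mul`). Thus multiplications by products of units and generators form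
a norming family of contractions. The mean value inequality is uniform over this family because the
candidate derivative is continuous, so differentiability passes to `b_A` itself
(`hasFDerivAt_of_norming`).

On the manifolds, every vector of `K^{p|q}` is the component vector of an even tangent vector
(`chartTangent_comp`), and charts may be shrunk until `f` maps them into a single chart
(`restrOpen_mem_atlas`). -/

noncomputable section

open Supernumber

/-! ### Signs, parity and norming by generators in the algebra of supernumbers -/

namespace Supernumber

variable {K : Type*} [RCLike K]

/-- The coefficient of `ζ^I` as a continuous linear functional. -/
def coeffL (I : Finset ℕ) : Supernumber K →L[K] K :=
  LinearMap.mkContinuous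
    { toFun := fun z => z.coeff I
      map_add' := fun _ _ => rfl
      map_smul' := fun _ _ => rfl } 1 fun z => by
    rw [one_mul, norm_eq_tsum]
    exact z.summable_coeff.le_tsum I fun _ _ => norm_nonneg _

/-- Multiplication of the coefficients by a bounded family of scalars. -/
def diagL (d : Finset ℕ → K) (hd : ∀ I, ‖d I‖ ≤ 1) : Supernumber K →L[K] Supernumber K :=
  have key (z : Supernumber K) (I : Finset ℕ) : ‖d I * z.coeff I‖ ≤ ‖z.coeff I‖ := by
    rw [norm_mul]
    exact mul_le_of_le_one_left (norm_nonneg _) (hd I)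
  have hs (z : Supernumber K) : Summable fun I => ‖d I * z.coeff I‖ :=
    Summable.of_nonneg_of_le (fun _ => norm_nonneg _) (key z) z.summable_coeff
  LinearMap.mkContinuous
    { toFun := fun z => mk (fun I => d I * z.coeff I) (hs z)
      map_add' := fun z w => ext_coeff fun I => by simp [mul_add]
      map_smul' := fun a z => ext_coeff fun I => by simp [mul_left_comm] } 1 fun z => by
    rw [one_mul, norm_eq_tsum, norm_eq_tsum]
    exact (hs z).tsum_le_tsum (key z) z.summable_coeff

@[simp] theorem coeff_diagL (d : Finset ℕ → K) (hd : ∀ I, ‖d I‖ ≤ 1) (z : Supernumber K)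
    (I : Finset ℕ) : (diagL d hd z).coeff I = d I * z.coeff I := rfl

/-- The projection of the supernumbers onto their part of parity `ε`. -/
def partL (ε : ZMod 2) : Supernumber K →L[K] Supernumber K :=
  diagL (fun I => if (I.card : ZMod 2) = ε then 1 else 0) fun I => by split_ifs <;> simp

theorem partL_mem (ε : ZMod 2) (z : Supernumber K) : partL ε z ∈ part K ε := fun I hI => by
  simp [partL, hI]

theorem partL_of_mem {ε : ZMod 2} {z : Supernumber K} (hz : z ∈ part K ε) : partL ε z = z :=
  ext_coeff fun I => by
    by_cases h : (I.card : ZMod 2) = ε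
    · simp [partL, h]
    · simp [partL, h, hz I h]

/-- The automorphism with `y * x = x * twistL ε y` for `x` of parity `ε`. -/
def twistL (ε : ZMod 2) : Supernumber K →L[K] Supernumber K :=
  diagL (fun I => (-1) ^ (ε.val * I.card)) fun I => by simp

@[simp] theorem coeff_twistL (ε : ZMod 2) (z : Supernumber K) (I : Finset ℕ) :
    (twistL ε z).coeff I = (-1) ^ (ε.val * I.card) * z.coeff I := rfl

/-- Each pair in `I ×ˢ J` has distinct entries by disjointness, so it is an inversion in exactly one
of the two orders. -/
theorem inv_add_inv {I J : Finset ℕ} (h : Disjoint I J) : inv I J + inv J I = I.card * J.card := by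
  have h2 : inv J I = ((I ×ˢ J).filter fun ij => ¬ ij.2 < ij.1).card := by
    unfold inv
    refine Finset.card_bij' (fun a _ => (a.2, a.1)) (fun a _ => (a.2, a.1)) ?_ ?_ ?_ ?_
    · rintro ⟨a, b⟩ hab
      simp only [Finset.mem_filter, Finset.mem_product] at hab ⊢
      exact ⟨⟨hab.1.2, hab.1.1⟩, by omega⟩
    · rintro ⟨a, b⟩ hab
      simp only [Finset.mem_filter, Finset.mem_product] at hab ⊢
      have : a ≠ b := fun e => Finset.disjoint_left.1 h hab.1.1 (e ▸ hab.1.2)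
      exact ⟨⟨hab.1.2, hab.1.1⟩, by omega⟩
    · simp
    · simp
  rw [h2, inv, Finset.card_filter_add_card_filter_not, Finset.card_product]

/-- Exchanging `ζ^I` and `ζ^(L \ I)` costs `(-1)^(|I| |L \ I|)`. Only terms with `|L \ I|` of parity
`ε` contribute, so the sign depends on `I` alone and can be absorbed into the coefficients of `y`,
which need not be homogeneous. -/
theorem mul_eq_mul_twistL {ε : ZMod 2} {x : Supernumber K} (hx : x ∈ part K ε)
    (y : Supernumber K) : y * x = x * twistL ε y := by
  refine ext_coeff fun L => ?_
  rw [coeff_mul, coeff_mul]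
  refine Finset.sum_bij' (fun I _ => L \ I) (fun I _ => L \ I) ?_ ?_ ?_ ?_ ?_
  · intro I _
    simp
  · intro I _
    simp
  · intro I hI
    simpa using Finset.mem_powerset.1 hI
  · intro I hI
    simpa using Finset.mem_powerset.1 hI
  · intro I hI
    have e : L \ (L \ I) = I := by simpa using Finset.mem_powerset.1 hI
    rw [e, coeff_twistL]
    by_cases hc : ((L \ I).card : ZMod 2) = ε
    · have hp : (-1 : K) ^ (ε.val * I.card) = (-1) ^ (inv I (L \ I) + inv (L \ I) I) := by
        rw [inv_add_inv Finset.disjoint_sdiff, ← hc, ZMod.val_natCast, mul_comm I.card, pow_mul,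
          pow_mul, ← neg_one_pow_eq_pow_mod_two]
      rw [hp, pow_add]
      have : ((-1 : K) ^ inv (L \ I) I) * (-1) ^ inv (L \ I) I = 1 := by
        rw [← mul_pow]; simp
      linear_combination (-((-1 : K) ^ inv I (L \ I) * (y.coeff I * x.coeff (L \ I)))) * this
    · rw [hx _ hc]
      simp

theorem zmod_two_cases : ∀ ε : ZMod 2, ε = 0 ∨ ε = 1 := by decide

theorem twistL_of_mem {ε δ : ZMod 2} {x : Supernumber K} (hx : x ∈ part K δ) :
    twistL ε x = superSign ε δ • x := by
  refine ext_coeff fun I => ?_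
  have hz (n : ℤ) : (n • x).coeff I = n • x.coeff I := map_zsmul (coeffL (K := K) I) n x
  rw [hz]
  by_cases hc : (I.card : ZMod 2) = δ
  · have h2 : (-1 : K) ^ (ε.val * I.card) = (-1) ^ (ε.val * δ.val) := by
      rw [← hc, ZMod.val_natCast, mul_comm, pow_mul, mul_comm, pow_mul (-1 : K) (I.card % 2),
        ← neg_one_pow_eq_pow_mod_two]
    rw [coeff_twistL, h2]
    obtain rfl | rfl := zmod_two_cases ε <;> obtain rfl | rfl := zmod_two_cases δ <;>
      simp [superSign, ZMod.val_one]
  · simp [hx I hc]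

theorem twistL_mul (ε : ZMod 2) (x y : Supernumber K) :
    twistL ε (x * y) = twistL ε x * twistL ε y := by
  refine ext_coeff fun L => ?_
  simp only [coeff_twistL, coeff_mul, Finset.mul_sum]
  refine Finset.sum_congr rfl fun I hI => ?_
  have hc : L.card = I.card + (L \ I).card := by
    rw [add_comm]
    exact (Finset.card_sdiff_add_card_eq_card (Finset.mem_powerset.1 hI)).symm
  rw [hc, mul_add, pow_add]
  ring

theorem supercomm {ε δ : ZMod 2} {x y : Supernumber K} (hx : x ∈ part K ε) (hy : y ∈ part K δ) :
    y * x = superSign ε δ • (x * y) := by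
  rw [mul_eq_mul_twistL hx, twistL_of_mem hy, mul_smul_comm]

theorem mul_mem_part {ε δ : ZMod 2} {x y : Supernumber K} (hx : x ∈ part K ε)
    (hy : y ∈ part K δ) : x * y ∈ part K (ε + δ) := by
  intro L hL
  rw [coeff_mul]
  refine Finset.sum_eq_zero fun I hI => ?_
  by_cases h1 : (I.card : ZMod 2) = ε
  · rw [hy (L \ I), mul_zero, mul_zero]
    rintro h2
    apply hL
    rw [← h1, ← h2, ← Nat.cast_add, Finset.card_sdiff_of_subset (Finset.mem_powerset.1 hI),
      Nat.add_sub_cancel' (Finset.card_le_card (Finset.mem_powerset.1 hI))]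
  · rw [hx I h1, zero_mul, mul_zero]

theorem one_mem_part : (1 : Supernumber K) ∈ part K 0 := by
  intro I hI
  rw [coeff_one, if_neg]
  rintro rfl
  simp at hI

theorem prod_ofFn_mem_part {k : ℕ} (ε : Fin k → ZMod 2) (x : Fin k → Supernumber K)
    (hx : ∀ i, x i ∈ part K (ε i)) : (List.ofFn x).prod ∈ part K (∑ i, ε i) := by
  induction k with
  | zero => simpa using one_mem_part
  | succ k ih =>
    rw [List.ofFn_succ, List.prod_cons, Fin.sum_univ_succ]
    exact mul_mem_part (hx 0) (ih _ _ fun i => hx i.succ)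

/-- The generator `ζ^n`. -/
def gen (n : ℕ) : Supernumber K :=
  mk (fun I => if I = {n} then 1 else 0)
    (summable_of_ne_finset_zero (s := {{n}}) (by intro I hI; simp_all))

theorem coeff_gen (n : ℕ) (I : Finset ℕ) :
    (gen n : Supernumber K).coeff I = if I = {n} then 1 else 0 := rfl

theorem gen_mem_part (n : ℕ) : (gen n : Supernumber K) ∈ part K 1 := by
  intro I hI
  rw [coeff_gen, if_neg]
  rintro rfl
  simp at hI

theorem norm_gen (n : ℕ) : ‖(gen n : Supernumber K)‖ = 1 := by
  rw [norm_eq_tsum, tsum_eq_single {n}]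
  · simp [coeff_gen]
  · intro I hI
    simp [coeff_gen, hI]

theorem norm_one_eq : ‖(1 : Supernumber K)‖ = 1 := by
  rw [norm_eq_tsum, tsum_eq_single ∅]
  · simp [coeff_one]
  · intro I hI
    simp [coeff_one, hI]

theorem norm_coeff_gen_mul {n : ℕ} {I : Finset ℕ} (hn : n ∉ I) (z : Supernumber K) :
    ‖(gen n * z).coeff (insert n I)‖ = ‖z.coeff I‖ := by
  rw [coeff_mul, Finset.sum_eq_single {n}]
  · have : insert n I \ {n} = I := by
      rw [Finset.insert_sdiff_of_mem _ (Finset.mem_singleton_self n)]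
      simpa using hn
    rw [this]
    simp [coeff_gen]
  · intro J _ hJ
    simp [coeff_gen, hJ]
  · simp

/-- A finite partial sum of `‖z‖` involves finitely many generators, so some `ζ^n` occurs in none of
them. Multiplication by it moves these terms injectively to other indices without changing their
absolute values. -/
theorem norm_le_of_gen_mul {z : Supernumber K} {C : ℝ} (h : ∀ n, ‖gen n * z‖ ≤ C) : ‖z‖ ≤ C := by
  rw [norm_eq_tsum]
  refine z.summable_coeff.tsum_le_of_sum_le fun F => ?_
  obtain ⟨n, hn⟩ := Infinite.exists_notMem_finset (F.biUnion id)
  have hn' : ∀ I ∈ F, n ∉ I := fun I hI h => hn (Finset.mem_biUnion.2 ⟨I, hI, h⟩)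
  calc ∑ I ∈ F, ‖z.coeff I‖ = ∑ I ∈ F, ‖(gen n * z).coeff (insert n I)‖ :=
        Finset.sum_congr rfl fun I hI => (norm_coeff_gen_mul (hn' I hI) z).symm
    _ = ∑ J ∈ F.image (insert n), ‖(gen n * z).coeff J‖ := by
        rw [Finset.sum_image]
        intro I hI J hJ hIJ
        rw [← Finset.erase_insert (hn' I hI), ← Finset.erase_insert (hn' J hJ), hIJ]
    _ ≤ ∑' J, ‖(gen n * z).coeff J‖ :=
        (gen n * z).summable_coeff.sum_le_tsum _ fun _ _ => norm_nonneg _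
    _ ≤ C := by
        rw [← norm_eq_tsum]
        exact h n

/-- A family of elements of parity `ε` and norm one: the unit for `ε = 0` and the generators for
`ε = 1`. -/
def testElem (ε : ZMod 2) (n : ℕ) : Supernumber K := if ε = 0 then 1 else gen n

theorem testElem_mem (ε : ZMod 2) (n : ℕ) : (testElem ε n : Supernumber K) ∈ part K ε := by
  obtain rfl | rfl := zmod_two_cases ε
  · simpa [testElem] using one_mem_part
  · simpa [testElem] using gen_mem_part n

theorem norm_testElem (ε : ZMod 2) (n : ℕ) : ‖(testElem ε n : Supernumber K)‖ = 1 := by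
  unfold testElem
  split_ifs
  · exact norm_one_eq
  · exact norm_gen n

theorem norm_prod_testElem_le {k : ℕ} (ε : Fin k → ZMod 2) (n : Fin k → ℕ) :
    ‖(List.ofFn fun i => (testElem (ε i) (n i) : Supernumber K)).prod‖ ≤ 1 := by
  induction k with
  | zero => simpa using norm_one_eq.le
  | succ k ih =>
    rw [List.ofFn_succ, List.prod_cons]
    refine (norm_mul_le _ _).trans ?_
    rw [norm_testElem, one_mul]
    exact ih _ _

theorem norm_le_of_prod_testElem_mul {k : ℕ} (ε : Fin k → ZMod 2) {z : Supernumber K} {C : ℝ}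
    (h : ∀ n : Fin k → ℕ,
      ‖(List.ofFn fun i => (testElem (ε i) (n i) : Supernumber K)).prod * z‖ ≤ C) : ‖z‖ ≤ C := by
  induction k with
  | zero => simpa using h Fin.elim0
  | succ k ih =>
    -- The first factor is removed for fixed later factors: it is the unit in the even case and
    -- ranges over all generators in the odd case.
    refine ih (fun i => ε i.succ) fun n => ?_
    have h' (m : ℕ) := h (Fin.cons m n)
    simp only [List.ofFn_succ, List.prod_cons, Fin.cons_zero, Fin.cons_succ, mul_assoc] at h'
    by_cases h0 : ε 0 = 0
    · simpa [testElem, h0] using h' 0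
    · exact norm_le_of_gen_mul fun m => by simpa [testElem, h0] using h' m

end Supernumber

/-! ### The space `K^{p|q}` and its G-linear maps -/

section SuperSpace

variable {K : Type*} [RCLike K] {p q : ℕ}

variable (K) in
/-- The coordinate `z^A` as a continuous linear map. -/
def coordL (A : Fin p ⊕ Fin q) : SuperSpace K p q →L[K] Supernumber K :=
  (PiLp.proj 1 (fun _ : Fin p ⊕ Fin q => Supernumber K) A).comp (superSubmodule K p q).subtypeL

@[simp] theorem coordL_apply (A : Fin p ⊕ Fin q) (z : SuperSpace K p q) :
    coordL K A z = z.1 A := rfl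

/-- The linear map `h ↦ ∑ h^A c_A`. -/
def gLin (c : Fin p ⊕ Fin q → Supernumber K) : SuperSpace K p q →L[K] Supernumber K :=
  ∑ A, ((ContinuousLinearMap.mul K (Supernumber K)).flip (c A)).comp (coordL K A)

@[simp] theorem gLin_apply (c : Fin p ⊕ Fin q → Supernumber K) (h : SuperSpace K p q) :
    gLin c h = ∑ A, h.1 A * c A := by
  simp [gLin]

variable (K p q) in
/-- `gLin` as a continuous linear map. -/
def gLinL : (Fin p ⊕ Fin q → Supernumber K) →L[K] SuperSpace K p q →L[K] Supernumber K :=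
  ∑ A, (((coordL K A).precomp (Supernumber K)).comp
    (ContinuousLinearMap.mul K (Supernumber K)).flip).comp
      (ContinuousLinearMap.proj (R := K) (φ := fun _ : Fin p ⊕ Fin q => Supernumber K) A)

theorem gLinL_apply (c : Fin p ⊕ Fin q → Supernumber K) : gLinL K p q c = gLin c := by
  ext1 h
  simp [gLinL]

variable (K p q) in
/-- The retraction of `Λ^{p+q}` onto `K^{p|q}` that projects each coordinate on its parity. -/
def retractL : (Fin p ⊕ Fin q → Supernumber K) →L[K] SuperSpace K p q :=
  ((PiLp.continuousLinearEquiv 1 K (fun _ : Fin p ⊕ Fin q =>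
      Supernumber K)).symm.toContinuousLinearMap.comp
    (ContinuousLinearMap.pi fun A => (partL (indexParity A)).comp (ContinuousLinearMap.proj A))).codRestrict
    (superSubmodule K p q) fun z A => by
      simpa using partL_mem (indexParity A) (z A)

theorem retractL_coord (z : SuperSpace K p q) : retractL K p q (fun A => z.1 A) = z := by
  ext A : 2
  exact partL_of_mem (z.2 A)

/-- The vector with `A`-th coordinate `x` and the other coordinates zero. -/
def superSingle (A : Fin p ⊕ Fin q) (x : Supernumber K) (hx : x ∈ part K (indexParity A)) :
    SuperSpace K p q :=
  ⟨WithLp.toLp 1 (Pi.single A x), fun B => by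
    by_cases h : B = A
    · subst h; simpa using hx
    · simp [h]⟩

@[simp] theorem superSingle_coord (A B : Fin p ⊕ Fin q) (x : Supernumber K)
    (hx : x ∈ part K (indexParity A)) :
    (superSingle A x hx).1 B = (Pi.single A x : Fin p ⊕ Fin q → Supernumber K) B := rfl

/-- `K^{p|q}` is only a subspace of a product, but the continuous linear `retractL` recovers a point
from its coordinates. -/
theorem contDiffOn_superSpace_iff {E : Type*} [NormedAddCommGroup E] [NormedSpace K E]
    {n : ℕ∞ω} {g : E → SuperSpace K p q} {s : Set E} :
    ContDiffOn K n g s ↔ ∀ A, ContDiffOn K n (fun z => (g z).1 A) s := by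
  refine ⟨fun h A => (coordL K A).contDiff.comp_contDiffOn h, fun h => ?_⟩
  have := (retractL K p q).contDiff.comp_contDiffOn (contDiffOn_pi.2 h)
  exact this.congr fun z _ => (retractL_coord (g z)).symm

theorem hasFDerivAt_clm_comp {E : Type*} [NormedAddCommGroup E] [NormedSpace K E]
    {f : E → Supernumber K} {f' : E →L[K] Supernumber K} {x : E}
    (L : Supernumber K →L[K] Supernumber K) (hf : HasFDerivAt f f' x) :
    HasFDerivAt (fun y => L (f y)) (L.comp f') x :=
  HasFDerivAt.comp x L.hasFDerivAt hf

/-- This makes the calculus of Fréchet derivatives available: a G-derivative is a Fréchet derivative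
of the special form `gLin`. -/
theorem isGOnNat_succ {s : ℕ} {f : SuperSpace K p q → Supernumber K}
    {U : Set (SuperSpace K p q)} :
    IsGOnNat (s + 1) f U ↔ ∃ G : Fin p ⊕ Fin q → SuperSpace K p q → Supernumber K,
      (∀ a ∈ U, HasFDerivAt f (gLin fun A => G A a) a) ∧ ∀ A, IsGOnNat s (G A) U := by
  simp only [hasFDerivAt_iff_isLittleO_nhds_zero, gLin_apply]
  rfl

/-! ### Calculus of functions of class G^s -/

namespace IsGOnNat

variable {s : ℕ} {f g : SuperSpace K p q → Supernumber K} {U V : Set (SuperSpace K p q)}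

theorem continuousOn (h : IsGOnNat s f U) : ContinuousOn f U := by
  cases s with
  | zero => exact h
  | succ s =>
    obtain ⟨G, hG, _⟩ := isGOnNat_succ.1 h
    exact fun a ha => (hG a ha).continuousAt.continuousWithinAt

theorem of_succ (h : IsGOnNat (s + 1) f U) : IsGOnNat s f U := by
  induction s generalizing f with
  | zero => exact h.continuousOn
  | succ s ih =>
    obtain ⟨G, hG, hG'⟩ := isGOnNat_succ.1 h
    exact isGOnNat_succ.2 ⟨G, hG, fun A => ih (hG' A)⟩

theorem mono (h : IsGOnNat s f U) (hVU : V ⊆ U) : IsGOnNat s f V := by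
  induction s generalizing f with
  | zero => exact ContinuousOn.mono h hVU
  | succ s ih =>
    obtain ⟨G, hG, hG'⟩ := isGOnNat_succ.1 h
    exact isGOnNat_succ.2 ⟨G, fun a ha => hG a (hVU ha), fun A => ih (hG' A)⟩

theorem congr (h : IsGOnNat s f U) (hU : IsOpen U) (hfg : Set.EqOn g f U) : IsGOnNat s g U := by
  cases s with
  | zero => exact ContinuousOn.congr h hfg
  | succ s =>
    obtain ⟨G, hG, hG'⟩ := isGOnNat_succ.1 h
    exact isGOnNat_succ.2 ⟨G, fun a ha =>
      (hG a ha).congr_of_eventuallyEq (hfg.eventuallyEq_of_mem (hU.mem_nhds ha)), hG'⟩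

theorem contDiffOn (h : IsGOnNat s f U) (hU : IsOpen U) : ContDiffOn K s f U := by
  induction s generalizing f with
  | zero => simpa using h.continuousOn
  | succ s ih =>
    obtain ⟨G, hG, hG'⟩ := isGOnNat_succ.1 h
    push_cast
    rw [contDiffOn_succ_iff_fderiv_of_isOpen hU]
    refine ⟨fun a ha => (hG a ha).differentiableAt.differentiableWithinAt, by simp, ?_⟩
    refine ((gLinL K p q).contDiff.comp_contDiffOn
      (contDiffOn_pi.2 fun A => ih (hG' A))).congr fun a ha => ?_
    rw [(hG a ha).fderiv]
    exact (gLinL_apply _).symm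

theorem const (c : Supernumber K) : IsGOnNat s (fun _ => c) U := by
  induction s generalizing c with
  | zero => exact continuousOn_const
  | succ s ih =>
    refine isGOnNat_succ.2 ⟨fun _ _ => 0, fun a _ =>
      (hasFDerivAt_const c a).congr_fderiv ?_, fun _ => ih 0⟩
    ext1 h
    simp

theorem zsmul (n : ℤ) (h : IsGOnNat s f U) : IsGOnNat s (fun a => n • f a) U := by
  induction s generalizing f with
  | zero => exact ContinuousOn.const_smul h n
  | succ s ih =>
    obtain ⟨G, hG, hG'⟩ := isGOnNat_succ.1 h
    refine isGOnNat_succ.2 ⟨fun A a => n • G A a, fun a ha =>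
      ((hG a ha).const_smul n).congr_fderiv ?_, fun A => ih (hG' A)⟩
    ext1 h
    change n • gLin _ h = _
    simp only [gLin_apply, Finset.smul_sum, mul_smul_comm]

/-- The twist is multiplicative and acts on `h^A` by a sign, so it carries `gLin` forms to `gLin`
forms. It is needed for the product rule. -/
theorem twist (ε : ZMod 2) (h : IsGOnNat s f U) : IsGOnNat s (fun a => twistL ε (f a)) U := by
  induction s generalizing f with
  | zero => exact (twistL ε).continuous.comp_continuousOn h
  | succ s ih =>
    obtain ⟨G, hG, hG'⟩ := isGOnNat_succ.1 h
    refine isGOnNat_succ.2 ⟨fun A a => superSign ε (indexParity A) • twistL ε (G A a),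
      fun a ha => ?_,
      fun A => zsmul _ (ih (hG' A))⟩
    have hc : HasFDerivAt (fun a => twistL ε (f a)) ((twistL ε).comp (gLin fun A => G A a)) a :=
      hasFDerivAt_clm_comp (twistL ε) (hG a ha)
    refine hc.congr_fderiv ?_
    ext1 h
    simp only [ContinuousLinearMap.comp_apply, gLin_apply, map_sum, twistL_mul]
    refine Finset.sum_congr rfl fun A _ => ?_
    rw [twistL_of_mem (h.2 A), smul_mul_assoc, mul_smul_comm]

theorem add (hf : IsGOnNat s f U) (hg : IsGOnNat s g U) : IsGOnNat s (fun a => f a + g a) U := by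
  induction s generalizing f g with
  | zero => exact ContinuousOn.add hf hg
  | succ s ih =>
    obtain ⟨F, hF, hF'⟩ := isGOnNat_succ.1 hf
    obtain ⟨G, hG, hG'⟩ := isGOnNat_succ.1 hg
    refine isGOnNat_succ.2 ⟨fun A a => F A a + G A a, fun a ha =>
      ((hF a ha).add (hG a ha)).congr_fderiv ?_, fun A => ih (hF' A) (hG' A)⟩
    ext1 h
    simp [mul_add, Finset.sum_add_distrib]

theorem sum {ι : Type*} (t : Finset ι) {f : ι → SuperSpace K p q → Supernumber K}
    (h : ∀ i ∈ t, IsGOnNat s (f i) U) : IsGOnNat s (fun a => ∑ i ∈ t, f i a) U := by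
  classical
  induction t using Finset.induction_on with
  | empty => simpa using const 0
  | insert i t hi ih =>
    simp only [Finset.sum_insert hi]
    exact (h i (by simp)).add (ih fun j hj => h j (by simp [hj]))

/-- In the Leibniz rule the term `f(a) h^A (G_A g)(a)` has `h^A` in the wrong place. Moving it to
the left twists `f(a)` by the parity of `A`. -/
theorem mul (hf : IsGOnNat s f U) (hg : IsGOnNat s g U) : IsGOnNat s (fun a => f a * g a) U := by
  induction s generalizing f g with
  | zero => exact ContinuousOn.mul hf hg
  | succ s ih =>
    have hf0 := hf.of_succ
    have hg0 := hg.of_succ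
    obtain ⟨F, hF, hF'⟩ := isGOnNat_succ.1 hf
    obtain ⟨G, hG, hG'⟩ := isGOnNat_succ.1 hg
    refine isGOnNat_succ.2 ⟨fun A a => F A a * g a + twistL (indexParity A) (f a) * G A a,
      fun a ha => ((hF a ha).mul' (hG a ha)).congr_fderiv ?_,
      fun A => (ih (hF' A) hg0).add (ih (hf0.twist _) (hG' A))⟩
    ext1 h
    change f a * gLin _ h + gLin _ h * g a = _
    simp only [gLin_apply, mul_add, Finset.sum_add_distrib, Finset.mul_sum, Finset.sum_mul]
    rw [add_comm]
    congr 1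
    · exact Finset.sum_congr rfl fun A _ => mul_assoc _ _ _
    · refine Finset.sum_congr rfl fun A _ => ?_
      rw [← mul_assoc, mul_eq_mul_twistL (h.2 A), mul_assoc]

theorem comp {p' q' : ℕ} {f : SuperSpace K p q → Supernumber K} {V : Set (SuperSpace K p q)}
    {θ : SuperSpace K p' q' → SuperSpace K p q} {W : Set (SuperSpace K p' q')}
    (hf : IsGOnNat s f V) (hθ : ∀ B, IsGOnNat s (fun a => (θ a).1 B) W) (hW : IsOpen W)
    (hm : Set.MapsTo θ W V) : IsGOnNat s (fun a => f (θ a)) W := by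
  induction s generalizing f with
  | zero =>
    have : ContinuousOn θ W := (contDiffOn_superSpace_iff (n := 0).2 fun B =>
      (hθ B).contDiffOn hW).continuousOn
    exact ContinuousOn.comp hf this hm
  | succ s ih =>
    obtain ⟨F, hF, hF'⟩ := isGOnNat_succ.1 hf
    have hθ0 := fun B => (hθ B).of_succ
    have hd : ContDiffOn K ((s + 1 : ℕ) : ℕ∞ω) θ W :=
      contDiffOn_superSpace_iff.2 fun B => (hθ B).contDiffOn hW
    choose G hG hG' using fun B => isGOnNat_succ.1 (hθ B)
    refine isGOnNat_succ.2 ⟨fun A a => ∑ B, G B A a * F B (θ a), fun a ha => ?_,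
      fun A => sum _ fun B _ => (hG' B A).mul (ih (hF' B) hθ0)⟩
    have hda : HasFDerivAt θ (fderiv K θ a) a :=
      ((hd.contDiffAt (hW.mem_nhds ha)).differentiableAt (by simp)).hasFDerivAt
    refine (HasFDerivAt.comp a (hF (θ a) (hm ha)) hda).congr_fderiv ?_
    ext1 h
    -- Uniqueness of the derivative identifies the components of the derivative of `θ` with the
    -- G-derivatives of its components.
    have hB (B : Fin p ⊕ Fin q) : (fderiv K θ a h).1 B = ∑ A, h.1 A * G B A a := by
      have h1 : HasFDerivAt (fun a => (θ a).1 B) ((coordL K B).comp (fderiv K θ a)) a :=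
        HasFDerivAt.comp a (coordL K B).hasFDerivAt hda
      have h2 := congrArg (fun L => L h) (h1.unique (hG B a ha))
      rw [gLin_apply] at h2
      exact h2
    simp only [ContinuousLinearMap.comp_apply, gLin_apply, hB, Finset.sum_mul, Finset.mul_sum]
    rw [Finset.sum_comm]
    exact Finset.sum_congr rfl fun A _ => Finset.sum_congr rfl fun B _ => mul_assoc _ _ _

end IsGOnNat

end SuperSpace

/-! ### Differentiability tested by a norming family -/

section Norming

variable {K : Type*} [RCLike K] {E F : Type*} [NormedAddCommGroup E] [NormedSpace K E]
  [NormedAddCommGroup F] [NormedSpace K F]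

/-- A map is differentiable with derivative `w` if its images under a norming family of
contractions are, with the corresponding derivatives, and `w` is continuous. -/
theorem hasFDerivAt_of_norming {ι : Type*} {T : ι → F →L[K] F} (hT : ∀ i, ‖T i‖ ≤ 1)
    (hT' : ∀ (z : F) (C : ℝ), (∀ i, ‖T i z‖ ≤ C) → ‖z‖ ≤ C) {u : E → F} {w : E → E →L[K] F}
    {V : Set E} {a : E} (hV : V ∈ 𝓝 a)
    (hd : ∀ x ∈ V, ∀ i, HasFDerivAt (fun y => T i (u y)) ((T i).comp (w x)) x)
    (hw : ContinuousAt w a) : HasFDerivAt u (w a) a := by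
  rw [hasFDerivAt_iff_isLittleO, Asymptotics.isLittleO_iff]
  intro c hc
  -- On this ball `‖w y - w a‖ ≤ c`. As the `T i` are contractions, the same bound holds after
  -- composing with `T i`, and neither `r` nor `c` depends on `i`.
  obtain ⟨r, hr, hball⟩ := Metric.mem_nhds_iff.1
    (Filter.inter_mem hV (hw (Metric.closedBall_mem_nhds (w a) hc)))
  filter_upwards [Metric.ball_mem_nhds a hr] with x hx
  refine hT' _ _ fun i => ?_
  -- The mean value inequality uses convexity of the ball, which refers to the real structure of
  -- `E`.
  let : NormedSpace ℝ E := NormedSpace.restrictScalars ℝ K E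
  have := (convex_ball a r).norm_image_sub_le_of_norm_hasFDerivWithin_le' (𝕜 := K)
    (f := fun y => T i (u y)) (f' := fun y => (T i).comp (w y)) (φ := (T i).comp (w a)) (C := c)
    (fun y hy => (hd y (hball hy).1 i).hasFDerivWithinAt) (fun y hy => ?_)
    (Metric.mem_ball_self hr) hx
  · simpa using this
  · rw [← ContinuousLinearMap.comp_sub]
    refine (ContinuousLinearMap.opNorm_comp_le _ _).trans ?_
    have h2 : ‖w y - w a‖ ≤ c := by simpa [dist_eq_norm] using (hball hy).2
    exact (mul_le_of_le_one_left (norm_nonneg _) (hT i)).trans h2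

theorem hasFDerivAt_iteratedFDeriv_apply {g : E → F} {a : E} (hg : ContDiffAt K ∞ g a) {k : ℕ}
    (m : Fin k → E) : ∃ L : E →L[K] F,
      (∀ h, L h = iteratedFDeriv K (k + 1) g a (Fin.cons h m)) ∧
      HasFDerivAt (fun x => iteratedFDeriv K k g x m) L a := by
  have hd : HasFDerivAt (iteratedFDeriv K k g) (fderiv K (iteratedFDeriv K k g) a) a :=
    (hg.differentiableAt_iteratedFDeriv (by exact_mod_cast WithTop.coe_lt_top _)).hasFDerivAt
  refine ⟨(ContinuousMultilinearMap.apply K (fun _ : Fin k => E) F m).comp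
    (fderiv K (iteratedFDeriv K k g) a), fun h => ?_,
    HasFDerivAt.comp a (ContinuousMultilinearMap.apply K (fun _ : Fin k => E) F m).hasFDerivAt hd⟩
  rw [iteratedFDeriv_succ_apply_left]
  simp

end Norming

/-! ### Coefficients of the iterated derivatives -/

section Tower

variable {K : Type*} [RCLike K] {p q : ℕ}

/-- The `k`-th derivative of `g` on `V` is `∑ h_1^{A_1} ⋯ h_k^{A_k} b_{A_1 … A_k}`. -/
def HasGDeriv (g : SuperSpace K p q → Supernumber K) (k : ℕ)
    (b : (Fin k → Fin p ⊕ Fin q) → SuperSpace K p q → Supernumber K)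
    (V : Set (SuperSpace K p q)) : Prop :=
  ∀ a ∈ V, ∀ m : Fin k → SuperSpace K p q, iteratedFDeriv K k g a m =
    ∑ A : Fin k → Fin p ⊕ Fin q, (List.ofFn fun i => (m i).1 (A i)).prod * b A a

theorem hasGDeriv_zero (g : SuperSpace K p q → Supernumber K) (V : Set (SuperSpace K p q)) :
    HasGDeriv g 0 (fun _ => g) V := fun a _ m => by
  simp

/-- Vectors supported in a single coordinate kill every multi-index but `A`, so one coefficient is
isolated up to a left factor. -/
theorem sum_prod_superSingle {k : ℕ} (A : Fin k → Fin p ⊕ Fin q) (η : Fin k → Supernumber K)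
    (hη : ∀ i, η i ∈ part K (indexParity (A i)))
    (b : (Fin k → Fin p ⊕ Fin q) → Supernumber K) :
    ∑ A' : Fin k → Fin p ⊕ Fin q,
      (List.ofFn fun i => (superSingle (A i) (η i) (hη i)).1 (A' i)).prod * b A' =
    (List.ofFn η).prod * b A := by
  rw [Finset.sum_eq_single A]
  · simp
  · intro A' _ hne
    obtain ⟨i, hi⟩ := Function.ne_iff.1 hne
    rw [List.prod_eq_zero, zero_mul]
    rw [List.mem_ofFn]
    exact ⟨i, by simp [hi]⟩
  · simp

theorem sum_prod_cons {k : ℕ} (h : SuperSpace K p q) (m : Fin k → SuperSpace K p q)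
    (c : (Fin (k + 1) → Fin p ⊕ Fin q) → Supernumber K) :
    ∑ A : Fin (k + 1) → Fin p ⊕ Fin q,
      (List.ofFn fun i => (Fin.cons h m : Fin (k + 1) → SuperSpace K p q) i |>.1 (A i)).prod * c A =
    ∑ B, h.1 B * ∑ A : Fin k → Fin p ⊕ Fin q,
      (List.ofFn fun i => (m i).1 (A i)).prod * c (Fin.cons B A) := by
  rw [← (Fin.consEquiv fun _ => Fin p ⊕ Fin q).sum_comp, Fintype.sum_prod_type]
  simp only [Finset.mul_sum, Fin.consEquiv_apply, List.ofFn_succ, List.prod_cons, Fin.cons_zero,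
    Fin.cons_succ, mul_assoc]
  rfl

variable {g : SuperSpace K p q → Supernumber K} {V : Set (SuperSpace K p q)} {k : ℕ}
  {b : (Fin k → Fin p ⊕ Fin q) → SuperSpace K p q → Supernumber K}

/-- For constant test elements `η`, the function `η_1 ⋯ η_k b_A` is a derivative of `g` along fixed
vectors, hence differentiable. Its derivative is read off from `c`, and the sign comes from moving
`h^B` past `η_1 ⋯ η_k`. The test products are norming, so they can be removed. -/
theorem HasGDeriv.hasFDerivAt (hV : IsOpen V) (hg : ContDiffOn K ∞ g V) (hb : HasGDeriv g k b V)
    {c : (Fin (k + 1) → Fin p ⊕ Fin q) → SuperSpace K p q → Supernumber K}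
    (hc : HasGDeriv g (k + 1) c V) (hcc : ∀ A, ContinuousOn (c A) V)
    (A : Fin k → Fin p ⊕ Fin q) {a : SuperSpace K p q} (ha : a ∈ V) :
    HasFDerivAt (b A) (gLin fun B =>
      superSign (∑ i, indexParity (A i)) (indexParity B) • c (Fin.cons B A) a) a := by
  let η (n : Fin k → ℕ) (i : Fin k) : Supernumber K := testElem (indexParity (A i)) (n i)
  have hη (n i) : η n i ∈ part K (indexParity (A i)) := testElem_mem _ _
  refine hasFDerivAt_of_norming
    (T := fun n => ContinuousLinearMap.mul K (Supernumber K) (List.ofFn (η n)).prod)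
    (w := fun x => gLin fun B =>
      superSign (∑ i, indexParity (A i)) (indexParity B) • c (Fin.cons B A) x)
    (fun n => (ContinuousLinearMap.opNorm_mul_apply_le _ _ _).trans (norm_prod_testElem_le _ _))
    (fun z C h => norm_le_of_prod_testElem_mul _ h) (hV.mem_nhds ha) (fun x hx n => ?_) ?_
  · obtain ⟨L, hL, hd⟩ := hasFDerivAt_iteratedFDeriv_apply (hg.contDiffAt (hV.mem_nhds hx))
      (fun i => superSingle (A i) (η n i) (hη n i))
    have he : (fun y => ContinuousLinearMap.mul K (Supernumber K) (List.ofFn (η n)).prod (b A y))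
        =ᶠ[𝓝 x] fun y => iteratedFDeriv K k g y fun i => superSingle (A i) (η n i) (hη n i) := by
      filter_upwards [hV.mem_nhds hx] with y hy
      rw [hb y hy, sum_prod_superSingle A (η n) (hη n) (fun A' => b A' y)]
      rfl
    refine (hd.congr_of_eventuallyEq he).congr_fderiv ?_
    ext1 h
    rw [hL, hc x hx, sum_prod_cons h _ (fun A' => c A' x)]
    simp only [ContinuousLinearMap.comp_apply, gLin_apply, ContinuousLinearMap.mul_apply',
      Finset.mul_sum]
    refine Finset.sum_congr rfl fun B _ => ?_
    rw [← Finset.mul_sum,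
      sum_prod_superSingle A (η n) (hη n) (fun A' => c (Fin.cons B A') x), ← mul_assoc,
      supercomm (prod_ofFn_mem_part _ (η n) (hη n)) (h.2 B), smul_mul_assoc, mul_smul_comm,
      mul_smul_comm, mul_assoc]
  · simp only [← gLinL_apply]
    refine (gLinL K p q).continuous.continuousAt.comp (continuousAt_pi.2 fun B => ?_)
    exact (continuous_zsmul _).continuousAt.comp
      ((hcc (Fin.cons B A)).continuousAt (hV.mem_nhds ha))

theorem HasGDeriv.succ (hV : IsOpen V) (hg : ContDiffOn K ∞ g V) (hb : HasGDeriv g k b V)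
    {c : (Fin k → Fin p ⊕ Fin q) → Fin p ⊕ Fin q → SuperSpace K p q → Supernumber K}
    (hc : ∀ A, ∀ a ∈ V, HasFDerivAt (b A) (gLin fun B => c A B a) a) :
    HasGDeriv g (k + 1) (fun A a => superSign (indexParity (A 0))
      (∑ i, indexParity (A (Fin.succ i))) • c (Fin.tail A) (A 0) a) V := by
  intro a ha m
  obtain ⟨L, hL, hd⟩ := hasFDerivAt_iteratedFDeriv_apply (hg.contDiffAt (hV.mem_nhds ha))
    (Fin.tail m)
  have he : (fun y => ∑ A : Fin k → Fin p ⊕ Fin q,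
      (List.ofFn fun i => (Fin.tail m i).1 (A i)).prod * b A y)
      =ᶠ[𝓝 a] fun y => iteratedFDeriv K k g y (Fin.tail m) := by
    filter_upwards [hV.mem_nhds ha] with y hy
    rw [hb y hy]
  have hs : HasFDerivAt (fun y => ∑ A : Fin k → Fin p ⊕ Fin q,
      (List.ofFn fun i => (Fin.tail m i).1 (A i)).prod * b A y)
      (∑ A : Fin k → Fin p ⊕ Fin q, (ContinuousLinearMap.mul K (Supernumber K)
        (List.ofFn fun i => (Fin.tail m i).1 (A i)).prod).comp (gLin fun B => c A B a)) a :=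
    HasFDerivAt.fun_sum fun A _ => HasFDerivAt.comp a (ContinuousLinearMap.mul K (Supernumber K)
      (List.ofFn fun i => (Fin.tail m i).1 (A i)).prod).hasFDerivAt (hc A a ha)
  -- The derivative of order `k + 1` is compared with the termwise derivative of the formula of
  -- order `k`, both evaluated at `m 0`.
  have h1 := congrArg (fun L => L (m 0)) ((hd.congr_of_eventuallyEq he).unique hs)
  simp only [hL, Fin.cons_self_tail] at h1
  rw [h1]
  conv_rhs => enter [2, A, 1, 1, 1, i]; rw [← Fin.cons_self_tail m]
  rw [sum_prod_cons (m 0) (Fin.tail m)]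
  simp only [sum_apply, ContinuousLinearMap.comp_apply, gLin_apply,
      ContinuousLinearMap.mul_apply', Finset.mul_sum, Fin.cons_zero, Fin.cons_succ, Fin.tail_cons]
  rw [Finset.sum_comm]
  refine Finset.sum_congr rfl fun B _ => Finset.sum_congr rfl fun A _ => ?_
  rw [← mul_assoc, supercomm ((m 0).2 B)
    (prod_ofFn_mem_part _ (fun i => (Fin.tail m i).1 (A i)) fun i => (Fin.tail m i).2 (A i)),
    smul_mul_assoc, mul_smul_comm, mul_smul_comm, mul_assoc]

theorem exists_hasGDeriv (hV : IsOpen V) (hg : ContDiffOn K ∞ g V) (k : ℕ) {j : ℕ}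
    (h : IsGOnNat (k + j) g V) :
    ∃ b : (Fin k → Fin p ⊕ Fin q) → SuperSpace K p q → Supernumber K,
      (∀ A, IsGOnNat j (b A) V) ∧ HasGDeriv g k b V := by
  induction k generalizing j with
  | zero => exact ⟨fun _ => g, fun _ => by simpa using h, hasGDeriv_zero g V⟩
  | succ k ih =>
    -- One order of G-smoothness of the coefficients is kept in reserve for the next
    -- differentiation.
    obtain ⟨b, hb, hbd⟩ := ih (j := j + 1) (by rwa [← add_assoc, add_right_comm])
    choose c hc hc' using fun A => isGOnNat_succ.1 (hb A)
    exact ⟨_, fun A => (hc' _ _).zsmul _, hbd.succ hV hg hc⟩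

/-- Descending from order `s`, where only continuity is claimed: each coefficient has the next ones,
up to sign, as G-derivatives. At `k = 0` the coefficient is `g` itself when `b 0` is so chosen. -/
theorem isGOnNat_of_hasGDeriv (hV : IsOpen V) (hg : ContDiffOn K ∞ g V) {s : ℕ}
    {b : (k : ℕ) → (Fin k → Fin p ⊕ Fin q) → SuperSpace K p q → Supernumber K}
    (hb : ∀ k ≤ s, HasGDeriv g k (b k) V) (hbc : ∀ k ≤ s, ∀ A, ContinuousOn (b k A) V)
    {j k : ℕ} (hk : k + j = s) (A : Fin k → Fin p ⊕ Fin q) : IsGOnNat j (b k A) V := by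
  induction j generalizing k with
  | zero => exact hbc k (by omega) A
  | succ j ih =>
    exact isGOnNat_succ.2 ⟨_, fun a ha => (hb k (by omega)).hasFDerivAt hV hg
      (hb (k + 1) (by omega)) (hbc (k + 1) (by omega)) A ha,
      fun B => (ih (by omega) (Fin.cons B A)).zsmul _⟩

end Tower

/-! ### Coordinate derivatives as even tangent vectors -/

section Manifold

variable {K : Type*} [RCLike K] {p q : ℕ}

theorem IsGOn.mono {l : ℕ∞} {f : SuperSpace K p q → Supernumber K} {U V : Set (SuperSpace K p q)}
    (h : IsGOn l f U) (hVU : V ⊆ U) : IsGOn l f V := fun s hs => (h s hs).mono hVU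

theorem IsGOn.contDiffOn {f : SuperSpace K p q → Supernumber K} {U : Set (SuperSpace K p q)}
    (h : IsGOn ⊤ f U) (hU : IsOpen U) : ContDiffOn K ∞ f U :=
  contDiffOn_infty.2 fun s => (h s le_top).contDiffOn hU

variable {M : Type*} [TopologicalSpace M]

theorem GCompatible.contDiffOn {ψ φ : OpenPartialHomeomorph M (SuperSpace K p q)}
    (h : GCompatible ψ φ) :
    ContDiffOn K ∞ (fun z => φ (ψ.symm z)) (ψ.symm.trans φ).source :=
  contDiffOn_superSpace_iff.2 fun A => (h A).contDiffOn (ψ.symm.trans φ).open_source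

variable (K p q M) in
theorem Supermanifold.isManifold [Supermanifold K p q M] : IsManifold 𝓘(K, SuperSpace K p q) ∞ M :=
  isManifold_of_contDiffOn _ _ _ fun e e' he he' => by
    simpa [Function.comp_def] using (Supermanifold.compatible e he e' he').contDiffOn

/-- The derivative of `f` in the chart `ψ` along the constant vector `h`. -/
def chartDir (ψ : OpenPartialHomeomorph M (SuperSpace K p q)) (h : SuperSpace K p q)
    (f : M → Supernumber K) (y : M) : Supernumber K :=
  fderiv K (fun z => f (ψ.symm z)) (ψ y) h

section chartDir

variable {ψ : OpenPartialHomeomorph M (SuperSpace K p q)} {h : SuperSpace K p q}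
  {f g : M → Supernumber K} {y : M} {W : Set M}

theorem tendsto_symm_nhds (hy : y ∈ ψ.source) : Filter.Tendsto ψ.symm (𝓝 (ψ y)) (𝓝 y) := by
  have := ψ.symm.continuousAt (ψ.map_source hy)
  rwa [ContinuousAt, ψ.left_inv hy] at this

theorem chartDir_congr (hy : y ∈ ψ.source) (hfg : f =ᶠ[𝓝 y] g) :
    chartDir ψ h f y = chartDir ψ h g y := by
  unfold chartDir
  rw [Filter.EventuallyEq.fderiv_eq]
  exact (tendsto_symm_nhds hy).eventually hfg

theorem chartDir_mem_part (hy : y ∈ ψ.source) {δ : ZMod 2} (hf : ∀ᶠ z in 𝓝 y, f z ∈ part K δ) :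
    chartDir ψ h f y ∈ part K δ := by
  unfold chartDir
  by_cases hd : DifferentiableAt K (fun z => f (ψ.symm z)) (ψ y)
  · have he : (fun z => f (ψ.symm z)) =ᶠ[𝓝 (ψ y)] fun z => partL δ (f (ψ.symm z)) :=
      ((tendsto_symm_nhds hy).eventually hf).mono fun z hz => (partL_of_mem hz).symm
    rw [((hasFDerivAt_clm_comp (partL δ) hd.hasFDerivAt).congr_of_eventuallyEq he).fderiv]
    exact partL_mem δ _
  -- No smoothness is assumed: the default value zero of `fderiv` has every parity. This serves
  -- arbitrary representatives of germs.
  · rw [fderiv_zero_of_not_differentiableAt hd]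
    exact (part K δ).zero_mem

variable [Supermanifold K p q M]

theorem IsGInfty.differentiableAt (hψ : ψ ∈ atlas (SuperSpace K p q) M)
    (hf : IsGInfty K p q f W) (hW : IsOpen W) (hy : y ∈ ψ.source) (hyW : y ∈ W) :
    DifferentiableAt K (fun z => f (ψ.symm z)) (ψ y) :=
  (((hf ψ hψ).contDiffOn (ψ.symm.isOpen_inter_preimage hW)).contDiffAt
    ((ψ.symm.isOpen_inter_preimage hW).mem_nhds
      ⟨ψ.map_source hy, by simpa [ψ.left_inv hy] using hyW⟩)).differentiableAt (by simp)

/-- In `ψ` the derivative is `∑ h^A G_A`, a combination with constant coefficients; the chain rule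
carries it to any other chart. -/
theorem isGInfty_chartDir (hψ : ψ ∈ atlas (SuperSpace K p q) M) (hW : IsOpen W)
    (hWψ : W ⊆ ψ.source) (hf : IsGInfty K p q f W) : IsGInfty K p q (chartDir ψ h f) W := by
  intro φ hφ s _
  have hV : IsOpen (ψ.target ∩ ψ.symm ⁻¹' W) := ψ.symm.isOpen_inter_preimage hW
  have hD : IsGOnNat s (fun a => fderiv K (fun z => f (ψ.symm z)) a h)
      (ψ.target ∩ ψ.symm ⁻¹' W) := by
    obtain ⟨G, hG, hG'⟩ := isGOnNat_succ.1 (hf ψ hψ (s + 1) le_top)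
    refine (IsGOnNat.sum Finset.univ fun A _ =>
      (IsGOnNat.const (h.1 A)).mul (hG' A)).congr hV fun a ha => ?_
    rw [(hG a ha).fderiv, gLin_apply]
  refine hD.comp (θ := fun z => ψ (φ.symm z)) (fun B =>
    (Supermanifold.compatible φ hφ ψ hψ B s le_top).mono ?_) (φ.symm.isOpen_inter_preimage hW) ?_
  · rintro z ⟨hz, hzW⟩
    simpa using ⟨hz, hWψ hzW⟩
  · rintro z ⟨hz, hzW⟩
    have hz' := hWψ hzW
    exact ⟨ψ.map_source hz', by simpa [ψ.left_inv hz'] using hzW⟩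

/-- The field is `∑ h^A ∂_A`, even because `h^A` has the parity of `∂_A`. As a directional
derivative it obeys the Leibniz rule without signs. -/
theorem isPureVectorField_chartDir (hψ : ψ ∈ atlas (SuperSpace K p q) M)
    (h : SuperSpace K p q) : IsPureVectorField K p q ψ.source 0 (chartDir ψ h) where
  restrict W hWψ hW f g _ _ hfg y hy :=
    chartDir_congr (hWψ hy) (hfg.eventuallyEq_of_mem (hW.mem_nhds hy))
  mapsTo W hWψ hW f hf := isGInfty_chartDir hψ hW hWψ hf
  parity W hWψ hW f hf δ hδ y hy := by
    rw [zero_add]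
    exact chartDir_mem_part (hWψ hy) (Filter.mem_of_superset (hW.mem_nhds hy) hδ)
  add W hWψ hW f g hf hg y hy := by
    unfold chartDir
    rw [fderiv_fun_add (hf.differentiableAt hψ hW (hWψ hy) hy)
      (hg.differentiableAt hψ hW (hWψ hy) hy)]
    rfl
  smul W hWψ hW f hf c y hy := by
    unfold chartDir
    rw [fderiv_fun_const_smul (hf.differentiableAt hψ hW (hWψ hy) hy)]
    rfl
  right_linear W hWψ hW f hf a y hy := by
    unfold chartDir
    rw [fderiv_mul_const' (hf.differentiableAt hψ hW (hWψ hy) hy)]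
    rfl
  leibniz W hWψ hW f g hf hg δ δ' _ _ y hy := by
    unfold chartDir
    rw [fderiv_fun_mul' (hf.differentiableAt hψ hW (hWψ hy) hy)
      (hg.differentiableAt hψ hW (hWψ hy) hy)]
    simp [superSign, ψ.left_inv (hWψ hy)]
    exact add_comm _ _
  left_linear W hWψ hW f hf δ δ' a ha _ y hy := by
    unfold chartDir
    rw [fderiv_const_mul (hf.differentiableAt hψ hW (hWψ hy) hy)]
    simp [superSign]

theorem isPureVectorField_zero (U : Set M) (ε : ZMod 2) :
    IsPureVectorField K p q U ε (fun _ _ => 0) where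
  restrict _ _ _ _ _ _ _ _ _ _ := rfl
  mapsTo _ _ _ _ _ _ _ _ _ := IsGOnNat.const 0
  parity _ _ _ _ _ _ _ _ _ := (part K _).zero_mem
  add := by simp
  smul := by simp
  right_linear := by simp
  leibniz := by simp
  left_linear := by simp

/-- The even tangent vector with components `h` in the chart `ψ`. -/
def chartTangent {x : M} (hψ : ψ ∈ atlas (SuperSpace K p q) M) (hx : x ∈ ψ.source)
    (h : SuperSpace K p q) : EvenTangent K p q x :=
  ⟨{ toFun := fun g => g.1.liftOn (fun f => chartDir ψ h f x) fun _ _ hfg => chartDir_congr hx hfg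
     exists_field := ⟨ψ.source, chartDir ψ h, ψ.open_source, hx,
      ⟨chartDir ψ h, fun _ _ => 0, isPureVectorField_chartDir hψ h, isPureVectorField_zero _ _,
        by simp⟩, fun _ _ _ _ _ _ => rfl⟩ }, by
    rintro δ ⟨g, hg⟩
    induction g using Filter.Germ.inductionOn with
    | _ f => exact fun hf => chartDir_mem_part hx hf⟩

/-- A condition on even tangent vectors thereby tests the derivative on all of `K^{p|q}`. -/
theorem chartTangent_comp {x : M} (hψ : ψ ∈ atlas (SuperSpace K p q) M) (hx : x ∈ ψ.source)
    (h : SuperSpace K p q) : (chartTangent hψ hx h).comp hψ hx = h := by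
  ext A : 2
  change fderiv K (fun z => (ψ (ψ.symm z)).1 A) (ψ x) h = h.1 A
  have he : (fun z => (ψ (ψ.symm z)).1 A) =ᶠ[𝓝 (ψ x)] coordL K A := by
    filter_upwards [ψ.open_target.mem_nhds (ψ.map_source hx)] with z hz
    rw [ψ.right_inv hz]
    rfl
  rw [he.fderiv_eq, ContinuousLinearMap.fderiv]
  rfl

/-- Changes of charts with the smaller chart are restrictions of the old ones, so maximality of the
atlas applies. -/
theorem restrOpen_mem_atlas (hψ : ψ ∈ atlas (SuperSpace K p q) M) {s : Set M} (hs : IsOpen s) :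
    ψ.restrOpen s hs ∈ atlas (SuperSpace K p q) M := by
  refine Supermanifold.maximal _ fun φ hφ => ⟨fun A => ?_, fun A => ?_⟩
  · refine (Supermanifold.compatible ψ hψ φ hφ A).mono ?_
    intro z hz
    simp at hz ⊢
    tauto
  · refine (Supermanifold.compatible φ hφ ψ hψ A).mono ?_
    intro z hz
    simp at hz ⊢
    tauto

end chartDir

end Manifold

/-! ### Chart representatives and the characterization of G^l maps -/

theorem mapsTo_symm_target {K : Type*} [RCLike K] {p q r s : ℕ} {M : Type*}
    [TopologicalSpace M] {N : Type*} [TopologicalSpace N] {f : M → N} {ψ : OpenPartialHomeomorph M (SuperSpace K p q)}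
    {φ : OpenPartialHomeomorph N (SuperSpace K r s)} (hfs : ψ.source ⊆ f ⁻¹' φ.source) :
    ψ.target ∩ ψ.symm ⁻¹' (f ⁻¹' φ.source) = ψ.target :=
  Set.inter_eq_left.2 fun _ hz => hfs (ψ.map_target hz)

section Main

variable {K : Type*} [RCLike K] {p q r s : ℕ}
    {M : Type*} [TopologicalSpace M] [Supermanifold K p q M]
    {N : Type*} [TopologicalSpace N] [Supermanifold K r s N]

theorem contDiffOn_chart_rep {f : M → N}
    (hf : ContMDiff 𝓘(K, SuperSpace K p q) 𝓘(K, SuperSpace K r s) ∞ f)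
    {ψ : OpenPartialHomeomorph M (SuperSpace K p q)} (hψ : ψ ∈ atlas (SuperSpace K p q) M)
    {φ : OpenPartialHomeomorph N (SuperSpace K r s)} (hφ : φ ∈ atlas (SuperSpace K r s) N)
    (hfs : ψ.source ⊆ f ⁻¹' φ.source) :
    ContDiffOn K ∞ (fun z => φ (f (ψ.symm z))) ψ.target := by
  have := Supermanifold.isManifold K p q M
  have := Supermanifold.isManifold K r s N
  have h := ((contMDiffOn_iff_of_mem_maximalAtlas
    (IsManifold.subset_maximalAtlas (I := 𝓘(K, SuperSpace K p q)) (n := ∞) hψ)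
    (IsManifold.subset_maximalAtlas (I := 𝓘(K, SuperSpace K r s)) (n := ∞) hφ)
    subset_rfl hfs).1 hf.contMDiffOn).2
  simpa [Function.comp_def, ψ.image_source_eq_target] using h

end Main

end

theorem mainTheorem6 {K : Type*} [RCLike K] {p q r s : ℕ}
    {M : Type*} [TopologicalSpace M] [Supermanifold K p q M]
    {N : Type*} [TopologicalSpace N] [Supermanifold K r s N]
    (f : M → N)
    (hf : ContMDiff 𝓘(K, SuperSpace K p q) 𝓘(K, SuperSpace K r s) ∞ f) (l : ℕ∞) :
    IsGMap K p q r s l f ↔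
      ∀ (ψ : OpenPartialHomeomorph M (SuperSpace K p q))
        (hψ : ψ ∈ atlas (SuperSpace K p q) M),
      ∀ φ ∈ atlas (SuperSpace K r s) N, ψ.source ⊆ f ⁻¹' φ.source →
        ∃ b : (k : ℕ) → (Fin k → Fin p ⊕ Fin q) → Fin r ⊕ Fin s → M → Supernumber K,
          ∀ k : ℕ, 1 ≤ k → (k : ℕ∞) ≤ l →
            (∀ A J, ContinuousOn (b k A J) ψ.source) ∧
            ∀ (x : M) (hx : x ∈ ψ.source) (X : Fin k → EvenTangent K p q x)
              (J : Fin r ⊕ Fin s),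
              chartDeriv hψ hx (fun y => (φ (f y)).1 J) X =
                ∑ A : Fin k → Fin p ⊕ Fin q,
                  (List.ofFn fun i => ((X i).comp hψ hx).1 (A i)).prod * b k A J x := by
  constructor
  · rintro ⟨-, h⟩ ψ hψ φ hφ hfs
    have hg := contDiffOn_superSpace_iff.1 (contDiffOn_chart_rep hf hψ hφ hfs)
    -- The bound `k ≤ l` is placed inside the existential so that coefficients can be chosen for
    -- every `k`; beyond `l` they are zero.
    have hex (k : ℕ) (J : Fin r ⊕ Fin s) :
        ∃ b : (Fin k → Fin p ⊕ Fin q) → SuperSpace K p q → Supernumber K, (k : ℕ∞) ≤ l →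
          (∀ A, ContinuousOn (b A) ψ.target) ∧
          HasGDeriv (fun z => (φ (f (ψ.symm z))).1 J) k b ψ.target := by
      by_cases hk : (k : ℕ∞) ≤ l
      · have hG := h ψ hψ φ hφ J k hk
        rw [mapsTo_symm_target hfs] at hG
        obtain ⟨b, hb, hbd⟩ := exists_hasGDeriv ψ.open_target (hg J) k (j := 0) hG
        exact ⟨b, fun _ => ⟨hb, hbd⟩⟩
      · exact ⟨fun _ _ => 0, fun h => absurd h hk⟩
    choose b hb using hex
    refine ⟨fun k A J y => b k J A (ψ y), fun k _ hk => ⟨fun A J => ?_, fun x hx X J => ?_⟩⟩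
    · exact ((hb k J hk).1 A).comp ψ.continuousOn ψ.mapsTo
    · exact (hb k J hk).2 (ψ x) (ψ.map_source hx) _
  · intro h
    refine ⟨hf.continuous, fun ψ₀ hψ₀ φ hφ J n hn => ?_⟩
    have ho : IsOpen (f ⁻¹' φ.source) := φ.open_source.preimage hf.continuous
    -- The hypothesis concerns only charts mapped by `f` into the domain of `φ`, so `ψ₀` is cut down
    -- to the preimage of that domain.
    let ψ := ψ₀.restrOpen _ ho
    have hψ : ψ ∈ atlas (SuperSpace K p q) M := restrOpen_mem_atlas hψ₀ ho
    have hfs : ψ.source ⊆ f ⁻¹' φ.source := by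
      intro y hy
      simp [ψ] at hy
      exact hy.2
    have ht : ψ₀.target ∩ ψ₀.symm ⁻¹' (f ⁻¹' φ.source) ⊆ ψ.target := by
      intro z hz
      simp [ψ] at hz ⊢
      exact hz
    have hg := contDiffOn_superSpace_iff.1 (contDiffOn_chart_rep hf hψ hφ hfs) J
    obtain ⟨b, hb⟩ := h ψ hψ φ hφ hfs
    -- The hypothesis provides coefficients only for `k ≥ 1`; in order zero the coefficient is the
    -- represented function.
    let c : (k : ℕ) → (Fin k → Fin p ⊕ Fin q) → SuperSpace K p q → Supernumber K
      | 0 => fun _ z => (φ (f (ψ.symm z))).1 J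
      | k + 1 => fun A z => b (k + 1) A J (ψ.symm z)
    have hc : ∀ k ≤ n, HasGDeriv (fun z => (φ (f (ψ.symm z))).1 J) k (c k) ψ.target ∧
        ∀ A, ContinuousOn (c k A) ψ.target := by
      intro k hk
      cases k with
      | zero => exact ⟨hasGDeriv_zero _ _, fun _ => hg.continuousOn⟩
      | succ k =>
        obtain ⟨h1, h2⟩ := hb (k + 1) (by omega) (le_trans (by exact_mod_cast hk) hn)
        refine ⟨fun a ha m => ?_, fun A => (h1 A J).comp ψ.symm.continuousOn ψ.symm.mapsTo⟩
        have hx := ψ.map_target ha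
        have h3 := h2 (ψ.symm a) hx (fun i => chartTangent hψ hx (m i)) J
        simp only [chartDeriv, chartTangent_comp, ψ.right_inv ha] at h3
        exact h3
    exact (isGOnNat_of_hasGDeriv (k := 0) ψ.open_target hg (fun k hk => (hc k hk).1)
      (fun k hk => (hc k hk).2) (zero_add n) Fin.elim0).mono ht
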